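/- Let $R$ be an integral domain that is a Pr\"ufer domain (every finitely generated ideal of $R$ is projective) and is $h$-local, that is, every nonzero prime ideal of $R$ is contained in exactly one maximal ideal and every nonzero element of $R$ is contained in only finitely many maximal ideals. Let $M$ be a torsion-free $R$-module of countable (that is, finite or countably infinite) rank. Then $M$ is isomorphic to a direct sum of ideals of $R$ if and only if every pure submodule of $M$ of finite rank is isomorphic to a direct sum of ideals of $R$. Here the rank of a torsion-free module is the cardinality of a maximal $R$-linearly independent subset, direct sums may be finite (including the empty sum $0$) or infinite, and a submodule $N \le M$ is pure if every finite system of equations $\sum_{j=1}^m r_{ij} x_j = a_i$ ($i = 1, \dots, n$) with $r_{ij} \in R$ and $a_i \in N$ that is solvable in $M$ is solvable in $N$. -/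

import Mathlib

universe u v

/-- An integral domain is a *Prüfer domain* if all its finitely generated ideals are projective. -/
def IsPruferDomain (R : Type u) [CommRing R] [IsDomain R] : Prop :=
  ∀ I : Ideal R, I.FG → Module.Projective R I

/-- An integral domain is *h-local* if every nonzero prime ideal is contained in exactly one maximal
ideal and every nonzero element is contained in only finitely many maximal ideals. -/
structure IsHLocalDomain (R : Type u) [CommRing R] [IsDomain R] : Prop where
  existsUnique_le_maximal :
    ∀ P : Ideal R, P.IsPrime → P ≠ ⊥ → ∃! m : Ideal R, m.IsMaximal ∧ P ≤ m
  finite_maximal_mem :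
    ∀ r : R, r ≠ 0 → {m : Ideal R | m.IsMaximal ∧ r ∈ m}.Finite

/-- A submodule `N` of `M` is *pure* if every finite system of linear equations
`∑ j, r i j • x j = a i` with coefficients in `R` and right-hand sides in `N` that is solvable in
`M` is solvable in `N`. -/
def IsPureSubmodule {R : Type u} {M : Type v} [CommRing R] [AddCommGroup M] [Module R M]
    (N : Submodule R M) : Prop :=
  ∀ (n m : ℕ) (r : Fin n → Fin m → R) (a : Fin n → M), (∀ i, a i ∈ N) →
    (∃ x : Fin m → M, ∀ i, ∑ j, r i j • x j = a i) →
    ∃ y : Fin m → M, (∀ j, y j ∈ N) ∧ ∀ i, ∑ j, r i j • y j = a i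

/-- `M` is isomorphic to an (external, possibly infinite or empty) direct sum of ideals of `R`.
The index type lives in the universe of `M`; this loses nothing, since zero ideals may be dropped
from a direct sum and the indices of the nonzero ones inject into `M`. -/
def IsDirectSumOfIdeals (R : Type u) (M : Type v) [CommRing R] [AddCommGroup M] [Module R M] :
    Prop :=
  ∃ (ι : Type v) (I : ι → Ideal R), Nonempty (M ≃ₗ[R] DirectSum ι (fun i => I i))

/-!
The key point is that every linear map `f : A₁ × ⋯ × Aₙ → R` defined on a finite product of ideals
splits over its range `J` (`exists_section_range_of_pi`). Each restriction `fᵢ : Aᵢ → R` is zero or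
injective, so with `Bᵢ = fᵢ(Aᵢ)` one has `J = ∑ Bᵢ`, and whenever `s J ⊆ Bᵢ`, multiplication by `s`
on `J` lifts through `f`. The elements of `R` whose multiplication on `J` lifts form an ideal, so it
is enough to find, for each maximal ideal `m`, an `s ∉ m` and an index `i` with `s J ⊆ Bᵢ`. Over a
valuation domain the `Bᵢ` form a chain and `s = 1` works; over a Prüfer domain the localizations of
the `Bᵢ` at `m` form a chain, and h-locality allows the denominators to be chosen uniformly
(`exists_notMem_forall_mul_mem_or`).

Call a module a *retract of ideals* if it is a direct summand of a finite product of ideals. The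
splitting property passes to such modules, and induction on the rank then gives two facts: a retract
of ideals is itself a finite direct sum of ideals (`IsRetractOfIdeals.exists_linearEquiv_pi`), and
every saturated submodule of it, that is, one with torsion-free quotient, is a direct summand
(`IsRetractOfIdeals.exists_retraction`). Moreover, a finite-rank module that embeds as a saturated
submodule in an arbitrary direct sum of ideals lands in finitely many of the summands, so it is a
retract of ideals (`isRetractOfIdeals_of_injective`).

Over a Prüfer domain torsion-free modules are flat, hence a submodule of a torsion-free module is
pure exactly when it is saturated. If `M` is a direct sum of ideals, its pure submodules of finite
rank are therefore retracts of ideals. Conversely, a torsion-free module of countable rank is the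
union of a chain of saturated submodules `N₀ = 0 ⊆ N₁ ⊆ ⋯` of finite rank; if these are direct sums
of ideals, then `Nₙ₊₁ = Nₙ ⊕ Dₙ` with `Dₙ` a finite direct sum of ideals, and `M` is the direct sum
of the `Dₙ`.
-/

/-! ### Ideals of h-local Prüfer domains -/

section Ring

variable {R : Type u} [CommRing R] [IsDomain R]

/-- The ideal `(a, b)` is principal locally at `m`. A splitting `s` of the projection `R² → (a, b)`
satisfies `a • s b = b • s a`, which forces `(s a)₀ + (s b)₁ = 1`, so one of these two elements lies
outside `m`. -/
theorem IsPruferDomain.exists_notMem_mul_mem_span (hR : IsPruferDomain R) (m : Ideal R)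
    [hm : m.IsMaximal] (a b : R) :
    ∃ t, t ∉ m ∧ (t * a ∈ Ideal.span {b} ∨ t * b ∈ Ideal.span {a}) := by
  have h1 : (1 : R) ∉ m := fun h => hm.ne_top ((Ideal.eq_top_iff_one m).2 h)
  by_cases ha : a = 0
  · exact ⟨1, h1, Or.inl (by simp [ha])⟩
  have hproj : Module.Projective R (Ideal.span {a, b} : Ideal R) :=
    hR _ (Submodule.fg_span (by simp))
  have haI : a ∈ (Ideal.span {a, b} : Ideal R) := Ideal.subset_span (by simp)
  have hbI : b ∈ (Ideal.span {a, b} : Ideal R) := Ideal.subset_span (by simp)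
  let π : (Fin 2 → R) →ₗ[R] (Ideal.span {a, b} : Ideal R) :=
    Fintype.linearCombination R ![⟨a, haI⟩, ⟨b, hbI⟩]
  have hπ : ∀ y, (π y : R) = y 0 * a + y 1 * b := by
    intro y
    simp [π, Fintype.linearCombination_apply, Fin.sum_univ_two]
  have hsurj : Function.Surjective π := by
    rintro ⟨x, hx⟩
    obtain ⟨c, d, hcd⟩ := Ideal.mem_span_pair.1 hx
    exact ⟨![c, d], Subtype.ext (by rw [hπ]; simpa using hcd)⟩
  obtain ⟨s, hs⟩ := Module.projective_lifting_property π LinearMap.id hsurj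
  have hs' : ∀ x : (Ideal.span {a, b} : Ideal R), (x : R) = s x 0 * a + s x 1 * b := by
    intro x
    rw [← hπ, ← LinearMap.comp_apply, hs, LinearMap.id_apply]
  have hab : a • s ⟨b, hbI⟩ = b • s ⟨a, haI⟩ := by
    rw [← map_smul, ← map_smul]
    exact congrArg s (Subtype.ext (mul_comm a b))
  have hab0 : a * s ⟨b, hbI⟩ 0 = b * s ⟨a, haI⟩ 0 := congrFun hab 0
  have hab1 : a * s ⟨b, hbI⟩ 1 = b * s ⟨a, haI⟩ 1 := congrFun hab 1
  have hsa := hs' ⟨a, haI⟩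
  have hone : s ⟨a, haI⟩ 0 + s ⟨b, hbI⟩ 1 = 1 := by
    apply mul_left_cancel₀ ha
    linear_combination hab1 - hsa
  by_cases h0 : s ⟨a, haI⟩ 0 ∈ m
  · refine ⟨s ⟨b, hbI⟩ 1, fun h => h1 (hone ▸ m.add_mem h0 h), Or.inl ?_⟩
    exact Ideal.mem_span_singleton'.2 ⟨s ⟨a, haI⟩ 1, by linear_combination -hab1⟩
  · exact ⟨_, h0, Or.inr (Ideal.mem_span_singleton'.2 ⟨s ⟨b, hbI⟩ 0, by linear_combination hab0⟩)⟩

theorem IsPruferDomain.valuationRing_localization (hR : IsPruferDomain R) (m : Ideal R)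
    [hm : m.IsMaximal] : ValuationRing (Localization m.primeCompl) := by
  have : IsDomain (Localization m.primeCompl) :=
    IsLocalization.isDomain_localization m.primeCompl_le_nonZeroDivisors
  rw [ValuationRing.iff_dvd_total]
  refine ⟨fun x y => ?_⟩
  obtain ⟨⟨a, s⟩, ha⟩ := IsLocalization.surj m.primeCompl x
  obtain ⟨⟨b, s'⟩, hb⟩ := IsLocalization.surj m.primeCompl y
  have hdvd : ∀ {a b t : R}, t ∉ m → t * a ∈ Ideal.span {b} →
      algebraMap R (Localization m.primeCompl) b ∣ algebraMap R _ a := by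
    intro a b t ht h
    have hu := IsLocalization.map_units (Localization m.primeCompl) (⟨t, ht⟩ : m.primeCompl)
    rw [← hu.dvd_mul_left, ← map_mul]
    exact map_dvd _ (Ideal.mem_span_singleton.1 h)
  have hx := IsLocalization.map_units (Localization m.primeCompl) s
  have hy := IsLocalization.map_units (Localization m.primeCompl) s'
  have hxy : x ∣ y ↔ algebraMap R (Localization m.primeCompl) a ∣ algebraMap R _ b := by
    rw [← ha, ← hb, hx.mul_right_dvd, hy.dvd_mul_right]
  have hyx : y ∣ x ↔ algebraMap R (Localization m.primeCompl) b ∣ algebraMap R _ a := by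
    rw [← ha, ← hb, hy.mul_right_dvd, hx.dvd_mul_right]
  rw [hxy, hyx]
  obtain ⟨t, ht, h | h⟩ := hR.exists_notMem_mul_mem_span m a b
  · exact Or.inr (hdvd ht h)
  · exact Or.inl (hdvd ht h)

theorem IsPruferDomain.flat (hR : IsPruferDomain R) (M : Type v) [AddCommGroup M] [Module R M]
    [Module.IsTorsionFree R M] : Module.Flat R M := by
  rw [Module.Flat.flat_iff_torsion_eq_bot_of_valuationRing_localization_isMaximal
    fun P _ => hR.valuationRing_localization P, ← Submodule.isTorsionFree_iff_torsion_eq_bot]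
  infer_instance

/-- Two distinct maximal ideals contain no common nonzero prime, so the multiplicative set generated
by their complements meets every nonzero principal ideal. -/
theorem IsHLocalDomain.exists_mul_mem_span (hR : IsHLocalDomain R) {m n : Ideal R}
    [m.IsMaximal] [n.IsMaximal] (hmn : m ≠ n) {b : R} (hb : b ≠ 0) :
    ∃ s t, s ∉ m ∧ t ∉ n ∧ s * t ∈ Ideal.span {b} := by
  by_contra! h
  obtain ⟨P, hP, hbP, hdisj⟩ := Ideal.exists_le_prime_disjoint (Ideal.span {b})
    (m.primeCompl ⊔ n.primeCompl) (by
      rw [Set.disjoint_left]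
      intro x hx hx'
      obtain ⟨s, hs, t, ht, rfl⟩ := Submonoid.mem_sup.1 hx'
      exact h s t hs ht hx)
  have hbP' : b ∈ P := hbP (Ideal.mem_span_singleton_self b)
  have hP0 : P ≠ ⊥ := fun h0 => hb (by simpa [h0] using hbP')
  have hPm : P ≤ m := fun x hx => by
    by_contra hxm
    exact Set.disjoint_left.1 hdisj hx ((le_sup_left : m.primeCompl ≤ _) hxm)
  have hPn : P ≤ n := fun x hx => by
    by_contra hxn
    exact Set.disjoint_left.1 hdisj hx ((le_sup_right : n.primeCompl ≤ _) hxn)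
  exact hmn ((hR.existsUnique_le_maximal P hP hP0).unique ⟨‹_›, hPm⟩ ⟨‹_›, hPn⟩)

/-- If the localization of `A` at `m` is contained in that of `B ≠ 0`, then a single denominator
outside `m` carries `A` into `B`. For a nonzero `b ∈ B`, the denominator is a product over the
finitely many maximal ideals `n ≠ m` containing `b` of elements outside `m` lying in the
localization of `(b)` at `n`. -/
theorem IsHLocalDomain.exists_notMem_forall_mul_mem (hR : IsHLocalDomain R) {m : Ideal R}
    [hm : m.IsMaximal] {A B : Ideal R} (hB : B ≠ ⊥) (h : ∀ a ∈ A, ∃ t, t ∉ m ∧ t * a ∈ B) :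
    ∃ s, s ∉ m ∧ ∀ a ∈ A, s * a ∈ B := by
  obtain ⟨b, hbB, hb⟩ := Submodule.exists_mem_ne_zero_of_ne_bot hB
  have hfin : {n : Ideal R | n.IsMaximal ∧ b ∈ n ∧ n ≠ m}.Finite :=
    (hR.finite_maximal_mem b hb).subset fun n hn => ⟨hn.1, hn.2.1⟩
  have key : ∀ n : Ideal R, ∃ s, s ∉ m ∧
      (n.IsMaximal ∧ b ∈ n ∧ n ≠ m → ∃ t, t ∉ n ∧ s * t ∈ Ideal.span {b}) := by
    intro n
    by_cases hn : n.IsMaximal ∧ b ∈ n ∧ n ≠ m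
    · have := hn.1
      obtain ⟨s, t, hs, ht, hst⟩ := hR.exists_mul_mem_span hn.2.2.symm hb
      exact ⟨s, hs, fun _ => ⟨t, ht, hst⟩⟩
    · exact ⟨1, fun h => hm.ne_top ((Ideal.eq_top_iff_one m).2 h), fun h => absurd h hn⟩
  choose s hsm hs using key
  refine ⟨∏ n ∈ hfin.toFinset, s n, fun hmem => ?_, fun a ha => ?_⟩
  · obtain ⟨n, -, hn⟩ := (Ideal.IsPrime.prod_mem_iff).1 hmem
    exact hsm n hn
  set σ := ∏ n ∈ hfin.toFinset, s n with hσ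
  -- The conductor of `σ * a` into `B` lies in no maximal ideal.
  have htop : B.colon {σ * a} = ⊤ := by
    by_contra hne
    obtain ⟨n, hn, hle⟩ := Ideal.exists_le_maximal _ hne
    have hmem : ∀ r, r * (σ * a) ∈ B → r ∈ n := fun r hr =>
      hle (Submodule.mem_colon_singleton.2 hr)
    have hbn : b ∈ n := hmem b (B.mul_mem_right _ hbB)
    by_cases hnm : n = m
    · obtain ⟨t, ht, hta⟩ := h a ha
      exact ht (hnm ▸ hmem t (by rw [mul_left_comm]; exact B.mul_mem_left _ hta))
    · obtain ⟨t, ht, hst⟩ := hs n ⟨hn, hbn, hnm⟩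
      refine ht (hmem t ?_)
      obtain ⟨c, hc⟩ : s n ∣ σ := Finset.dvd_prod_of_mem s (hfin.mem_toFinset.2 ⟨hn, hbn, hnm⟩)
      have hle' : Ideal.span {b} ≤ B := (Ideal.span_singleton_le_iff_mem B).2 hbB
      have : t * (σ * a) = c * a * (s n * t) := by rw [hc]; ring
      rw [this]
      exact B.mul_mem_left _ (hle' hst)
  have h1 : (1 : R) ∈ B.colon {σ * a} := htop ▸ Submodule.mem_top
  simpa using Submodule.mem_colon_singleton.1 h1

/-- Any two ideals are comparable locally at `m`, with a uniform denominator. -/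
theorem exists_notMem_forall_mul_mem_or (hP : IsPruferDomain R) (hR : IsHLocalDomain R)
    (m : Ideal R) [hm : m.IsMaximal] (A B : Ideal R) :
    ∃ s, s ∉ m ∧ ((∀ a ∈ A, s * a ∈ B) ∨ ∀ b ∈ B, s * b ∈ A) := by
  have h1 : (1 : R) ∉ m := fun h => hm.ne_top ((Ideal.eq_top_iff_one m).2 h)
  by_cases hA : A = ⊥
  · exact ⟨1, h1, Or.inl fun a ha => by simp_all⟩
  by_cases hB : B = ⊥
  · exact ⟨1, h1, Or.inr fun a ha => by simp_all⟩
  by_cases h : ∀ a ∈ A, ∃ t, t ∉ m ∧ t * a ∈ B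
  · obtain ⟨s, hs, hs'⟩ := hR.exists_notMem_forall_mul_mem hB h
    exact ⟨s, hs, Or.inl hs'⟩
  · push Not at h
    obtain ⟨a, ha, hna⟩ := h
    obtain ⟨s, hs, hs'⟩ := hR.exists_notMem_forall_mul_mem (m := m) (A := B) hA fun b hb => by
      obtain ⟨t, ht, h | h⟩ := hP.exists_notMem_mul_mem_span m a b
      · exact absurd ((Ideal.span_singleton_le_iff_mem B).2 hb h) (hna t ht)
      · exact ⟨t, ht, (Ideal.span_singleton_le_iff_mem A).2 ha h⟩
    exact ⟨s, hs, Or.inr hs'⟩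

/-- Among finitely many ideals, one contains all the others locally at `m`. -/
theorem exists_notMem_forall_mul_mem_of_nonempty (hP : IsPruferDomain R) (hR : IsHLocalDomain R)
    (m : Ideal R) [hm : m.IsMaximal] {ι : Type*} (B : ι → Ideal R) {T : Finset ι}
    (hT : T.Nonempty) : ∃ i ∈ T, ∃ s, s ∉ m ∧ ∀ j ∈ T, ∀ b ∈ B j, s * b ∈ B i := by
  classical
  induction hT using Finset.Nonempty.cons_induction with
  | singleton i =>
    refine ⟨i, by simp, 1, fun h => hm.ne_top ((Ideal.eq_top_iff_one m).2 h), ?_⟩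
    simp
  | cons k T hk hT ih =>
    obtain ⟨i, hi, s, hs, h⟩ := ih
    obtain ⟨t, ht, h' | h'⟩ := exists_notMem_forall_mul_mem_or hP hR m (B i) (B k)
    · refine ⟨k, by simp, t * s, hm.isPrime.mul_notMem ht hs, fun j hj b hb => ?_⟩
      rw [Finset.mem_cons] at hj
      rcases hj with rfl | hj
      · exact (B _).mul_mem_left _ hb
      · rw [mul_assoc]
        exact h' _ (h j hj b hb)
    · refine ⟨i, by simp [hi], t * s, hm.isPrime.mul_notMem ht hs, fun j hj b hb => ?_⟩
      rw [Finset.mem_cons] at hj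
      rcases hj with rfl | hj
      · rw [mul_right_comm]
        exact (B i).mul_mem_right _ (h' _ hb)
      · rw [mul_assoc]
        exact (B i).mul_mem_left _ (h j hj b hb)

/-- This holds because `a * f b = b * f a` for all `a b ∈ A`. -/
theorem Ideal.eq_zero_or_injective_linearMap (A : Ideal R) (f : A →ₗ[R] R) :
    f = 0 ∨ Function.Injective f := by
  by_cases h : Function.Injective f
  · exact Or.inr h
  left
  rw [injective_iff_map_eq_zero] at h
  push Not at h
  obtain ⟨a, ha, ha0⟩ := h
  ext b
  have hab : (a : R) * f b = (b : R) * f a := by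
    rw [← smul_eq_mul, ← smul_eq_mul, ← map_smul, ← map_smul]
    exact congrArg f (Subtype.ext (mul_comm (a : R) b))
  rw [ha, mul_zero] at hab
  simpa [ha0] using hab

/-- Every linear map from a finite product of ideals to the ring splits over its range. -/
theorem exists_section_range_of_pi (hP : IsPruferDomain R) (hR : IsHLocalDomain R) {n : ℕ}
    (A : Fin n → Ideal R) (f : (∀ i, A i) →ₗ[R] R) :
    ∃ s : LinearMap.range f →ₗ[R] ∀ i, A i, ∀ y, f (s y) = y := by
  -- The multipliers whose action on the range of `f` lifts through `f`.
  let C : Ideal R :=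
    { carrier := {r | ∃ s : LinearMap.range f →ₗ[R] ∀ i, A i, ∀ y, f (s y) = r * y}
      zero_mem' := ⟨0, by simp⟩
      add_mem' := by
        rintro a b ⟨s, hs⟩ ⟨t, ht⟩
        exact ⟨s + t, fun y => by simp [hs, ht, add_mul]⟩
      smul_mem' := by
        rintro c a ⟨s, hs⟩
        exact ⟨c • s, fun y => by simp [hs, mul_assoc]⟩ }
  suffices h : C = ⊤ by
    obtain ⟨s, hs⟩ : (1 : R) ∈ C := h ▸ Submodule.mem_top
    exact ⟨s, fun y => by simpa using hs y⟩
  by_contra hC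
  obtain ⟨m, hm, hle⟩ := Ideal.exists_le_maximal C hC
  let g : ∀ i, A i →ₗ[R] R := fun i => f ∘ₗ LinearMap.single R (fun i => A i) i
  have hf : ∀ y, f y = ∑ i, g i (y i) := by
    intro y
    conv_lhs => rw [← LinearMap.sum_single_apply (fun i => A i) y, map_sum]
    rfl
  rcases Nat.eq_zero_or_pos n with rfl | hn
  · have : (1 : R) ∈ C := ⟨0, by
      rintro ⟨_, y, rfl⟩
      simp [hf y]⟩
    exact hm.ne_top ((Ideal.eq_top_iff_one m).2 (hle this))
  have : NeZero n := ⟨hn.ne'⟩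
  obtain ⟨i, -, s, hs, hsi⟩ := exists_notMem_forall_mul_mem_of_nonempty hP hR m
    (fun i => LinearMap.range (g i)) (Finset.univ_nonempty (α := Fin n))
  apply hs
  apply hle
  have hrange : ∀ y ∈ LinearMap.range f, s * y ∈ LinearMap.range (g i) := by
    rintro _ ⟨y, rfl⟩
    rw [hf, Finset.mul_sum]
    exact Submodule.sum_mem _ fun j _ => hsi j (Finset.mem_univ j) _ ⟨_, rfl⟩
  rcases (A i).eq_zero_or_injective_linearMap (g i) with h0 | hinj
  · refine ⟨0, fun y => ?_⟩
    have := hrange y y.2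
    rw [h0, LinearMap.range_zero, Submodule.mem_bot] at this
    simp [this]
  · let e := LinearEquiv.ofInjective (g i) hinj
    let μ : LinearMap.range f →ₗ[R] LinearMap.range (g i) :=
      LinearMap.codRestrict _ (s • (LinearMap.range f).subtype) fun y => hrange y y.2
    -- Multiplication by `s` sends `range f` into `range (g i)`, which `g i` identifies with `A i`.
    refine ⟨LinearMap.single R (fun i => A i) i ∘ₗ e.symm.toLinearMap ∘ₗ μ, fun y => ?_⟩
    have h : (e (e.symm (μ y)) : R) = μ y := by rw [e.apply_symm_apply]
    exact h

end Ring

/-! ### Saturated submodules and retracts of ideals -/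

section Module

variable {R : Type u} [CommRing R]

/-- `K` is saturated in `N`; over a domain this says that `N ⧸ K` is torsion-free. -/
def Submodule.IsSaturated {N : Type*} [AddCommGroup N] [Module R N] (K : Submodule R N) : Prop :=
  ∀ (r : R) (x : N), r ≠ 0 → r • x ∈ K → x ∈ K

/-- A module is a *retract of ideals* if it is a direct summand of a finite direct sum of ideals of
the ring, up to isomorphism. -/
def IsRetractOfIdeals (R : Type u) [CommRing R] (N : Type*) [AddCommGroup N] [Module R N] : Prop :=
  ∃ (n : ℕ) (A : Fin n → Ideal R) (i : N →ₗ[R] ∀ j, A j) (p : (∀ j, A j) →ₗ[R] N),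
    ∀ x, p (i x) = x

theorem IsRetractOfIdeals.of_retract {N P : Type*} [AddCommGroup N] [Module R N] [AddCommGroup P]
    [Module R P] (hN : IsRetractOfIdeals R N) (j : P →ₗ[R] N) (q : N →ₗ[R] P)
    (hq : ∀ x, q (j x) = x) : IsRetractOfIdeals R P := by
  obtain ⟨n, A, i, p, hp⟩ := hN
  exact ⟨n, A, i ∘ₗ j, q ∘ₗ p, fun x => by simp [hp, hq]⟩

theorem isRetractOfIdeals_pi {ι : Type*} [Finite ι] (A : ι → Ideal R) :
    IsRetractOfIdeals R (∀ i, A i) := by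
  obtain ⟨n, ⟨e⟩⟩ := Finite.exists_equiv_fin ι
  let E : (∀ i, A i) ≃ₗ[R] ∀ j, A (e.symm j) :=
    (LinearEquiv.piCongrLeft R (fun i => A i) e.symm).symm
  exact ⟨n, fun j => A (e.symm j), E.toLinearMap, E.symm.toLinearMap, E.symm_apply_apply⟩

theorem IsRetractOfIdeals.exists_injective {N : Type*} [AddCommGroup N] [Module R N]
    (hN : IsRetractOfIdeals R N) :
    ∃ (n : ℕ) (i : N →ₗ[R] Fin n → R), Function.Injective i := by
  obtain ⟨n, A, i, p, hp⟩ := hN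
  refine ⟨n, LinearMap.pi fun j => (A j).subtype ∘ₗ LinearMap.proj j ∘ₗ i, fun x y hxy => ?_⟩
  rw [← hp x, ← hp y]
  congr 1
  ext j
  exact congrFun hxy j

/-- A section `s` of `f` over its range yields the projection `x ↦ x - s (f x)` onto the kernel. -/
theorem exists_retraction_ker {N : Type*} [AddCommGroup N] [Module R N] {f : N →ₗ[R] R}
    {s : LinearMap.range f →ₗ[R] N} (hs : ∀ y, f (s y) = y) :
    ∃ ρ : N →ₗ[R] LinearMap.ker f, ∀ x, (ρ x : N) = x - s (f.rangeRestrict x) :=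
  ⟨LinearMap.codRestrict _ (LinearMap.id - s ∘ₗ f.rangeRestrict) fun x => by simp [hs],
    fun _ => rfl⟩

variable [IsDomain R]

theorem Submodule.isSaturated_ker {N P : Type*} [AddCommGroup N] [Module R N] [AddCommGroup P]
    [Module R P] [Module.IsTorsionFree R P] (f : N →ₗ[R] P) :
    (LinearMap.ker f).IsSaturated := by
  intro r x hr hx
  rw [LinearMap.mem_ker, map_smul] at hx
  exact (smul_eq_zero.1 hx).resolve_left hr

theorem IsRetractOfIdeals.exists_rank_le {N : Type v} [AddCommGroup N] [Module R N]
    (hN : IsRetractOfIdeals R N) : ∃ k : ℕ, Module.rank R N ≤ k := by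
  obtain ⟨n, i, hi⟩ := hN.exists_injective
  refine ⟨n, ?_⟩
  have h := LinearMap.lift_rank_le_of_injective i hi
  rw [rank_fin_fun, Cardinal.lift_natCast, ← Cardinal.lift_natCast.{u, v},
    Cardinal.lift_le] at h
  exact h

/-- The range of `f` equals that of its composition with the projection from a finite product of
ideals. -/
theorem IsRetractOfIdeals.exists_section_range (hP : IsPruferDomain R) (hR : IsHLocalDomain R)
    {N : Type*} [AddCommGroup N] [Module R N] (hN : IsRetractOfIdeals R N) (f : N →ₗ[R] R) :
    ∃ s : LinearMap.range f →ₗ[R] N, ∀ y, f (s y) = y := by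
  obtain ⟨n, A, i, p, hp⟩ := hN
  obtain ⟨s, hs⟩ := exists_section_range_of_pi hP hR A (f ∘ₗ p)
  have hle : LinearMap.range f ≤ LinearMap.range (f ∘ₗ p) := by
    rintro _ ⟨x, rfl⟩
    exact ⟨i x, by simp [hp]⟩
  exact ⟨p ∘ₗ s ∘ₗ Submodule.inclusion hle, fun y => hs (Submodule.inclusion hle y)⟩

/-- The rank drops when passing to a submodule whose quotient is not torsion; this drives the
inductions on the rank. -/
theorem rank_le_of_forall_smul_notMem {N : Type v} [AddCommGroup N] [Module R N]
    {K : Submodule R N} {x : N} (hx : ∀ r : R, r ≠ 0 → r • x ∉ K) {k : ℕ}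
    (hk : Module.rank R N ≤ (k + 1 : ℕ)) : Module.rank R K ≤ k := by
  have h1 : 1 ≤ Module.rank R (N ⧸ K) := by
    rw [Cardinal.one_le_iff_ne_zero, Ne, Module.rank_eq_zero_iff_isTorsion]
    intro h
    obtain ⟨⟨r, hr⟩, hrx⟩ := @h (K.mkQ x)
    refine hx r (nonZeroDivisors.ne_zero hr) ?_
    rw [← Submodule.ker_mkQ K, LinearMap.mem_ker, map_smul]
    exact hrx
  have h2 := rank_quotient_add_rank_of_isDomain K
  have h3 : 1 + Module.rank R K ≤ 1 + (k : Cardinal) := by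
    calc 1 + Module.rank R K ≤ Module.rank R (N ⧸ K) + Module.rank R K := by gcongr
      _ ≤ _ := by rw [h2]; simpa [add_comm] using hk
  rw [add_comm 1, add_comm 1] at h3
  exact (Cardinal.add_le_add_iff_of_lt_aleph0 Cardinal.one_lt_aleph0).1 h3

/-- A saturated submodule of a submodule of `Rⁿ` is cut out by linear forms: pass to the fraction
field, separate `x` from the span of `K` there, and clear denominators. -/
theorem exists_linearMap_ne_zero_of_notMem {N : Type*} [AddCommGroup N] [Module R N] {n : ℕ}
    {i : N →ₗ[R] Fin n → R} (hi : Function.Injective i) {K : Submodule R N} (hK : K.IsSaturated)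
    {x : N} (hx : x ∉ K) : ∃ f : N →ₗ[R] R, K ≤ LinearMap.ker f ∧ f x ≠ 0 := by
  let F := FractionRing R
  let j : N →ₗ[R] Fin n → F := LinearMap.pi fun k => Algebra.linearMap R F ∘ₗ LinearMap.proj k ∘ₗ i
  have hj : Function.Injective j := fun y z hyz => hi <| funext fun k =>
    IsFractionRing.injective R F (congrFun hyz k)
  -- Elements of the `F`-span of `K` become elements of `K` after clearing denominators.
  have hspan : ∀ z ∈ Submodule.span F (j '' K), ∃ r : R, r ≠ 0 ∧ ∃ y ∈ K, j y = r • z := by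
    intro z hz
    induction hz using Submodule.span_induction with
    | mem z hz =>
      obtain ⟨y, hy, rfl⟩ := hz
      exact ⟨1, one_ne_zero, y, hy, by simp⟩
    | zero => exact ⟨1, one_ne_zero, 0, K.zero_mem, by simp⟩
    | add z w _ _ hz hw =>
      obtain ⟨r, hr, y, hy, hyz⟩ := hz
      obtain ⟨t, ht, y', hy', hyw⟩ := hw
      refine ⟨r * t, mul_ne_zero hr ht, t • y + r • y',
        K.add_mem (K.smul_mem _ hy) (K.smul_mem _ hy'), ?_⟩
      rw [map_add, map_smul, map_smul, hyz, hyw, smul_add, smul_smul, smul_smul, mul_comm t r]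
    | smul c z _ hz =>
      obtain ⟨r, hr, y, hy, hyz⟩ := hz
      obtain ⟨a, d, hd, rfl⟩ := IsFractionRing.div_surjective (A := R) c
      refine ⟨d * r, mul_ne_zero (nonZeroDivisors.ne_zero hd) hr, a • y, K.smul_mem _ hy, ?_⟩
      have hd' : algebraMap R F d ≠ 0 := IsFractionRing.to_map_ne_zero_of_mem_nonZeroDivisors hd
      have hsmul : ∀ (t : R) (w : F), t • w = algebraMap R F t * w := Algebra.smul_def
      rw [map_smul, hyz]
      ext k
      simp only [Pi.smul_apply, hsmul, smul_eq_mul, map_mul]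
      have hq : algebraMap R F d * (algebraMap R F a / algebraMap R F d) = algebraMap R F a :=
        mul_div_cancel₀ _ hd'
      linear_combination (-(algebraMap R F r * z k)) * hq
  have hjx : j x ∉ Submodule.span F (j '' K) := by
    intro h
    obtain ⟨r, hr, y, hy, hyx⟩ := hspan _ h
    rw [← map_smul] at hyx
    exact hx (hK r x hr (hj hyx ▸ hy))
  obtain ⟨g, hgx, hgK⟩ := Submodule.exists_le_ker_of_notMem hjx
  obtain ⟨⟨d, hd⟩, hc⟩ := IsLocalization.exist_integer_multiples_of_finite (nonZeroDivisors R)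
    fun k : Fin n => g (Pi.single k 1)
  choose c hc using hc
  have hd' : algebraMap R F d ≠ 0 := IsFractionRing.to_map_ne_zero_of_mem_nonZeroDivisors hd
  let f : N →ₗ[R] R := ∑ k, c k • LinearMap.proj k ∘ₗ i
  have hf : ∀ y, algebraMap R F (f y) = algebraMap R F d * g (j y) := by
    intro y
    have h : g (j y) = ∑ k, j y k * g (Pi.single k 1) := by
      conv_lhs => rw [pi_eq_sum_univ' (j y), map_sum]
      exact Finset.sum_congr rfl fun k _ => by
        rw [map_smul, smul_eq_mul]
    rw [h, Finset.mul_sum]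
    simp only [f, LinearMap.sum_apply, map_sum]
    refine Finset.sum_congr rfl fun k _ => ?_
    have := hc k
    simp only [Algebra.smul_def] at this
    simp only [LinearMap.smul_apply, smul_eq_mul, map_mul, this]
    simp only [j, LinearMap.pi_apply, LinearMap.comp_apply, LinearMap.proj_apply,
      Algebra.linearMap_apply]
    ring
  refine ⟨f, fun y hy => ?_, fun h => ?_⟩
  · have h0 : g (j y) = 0 := hgK (Submodule.subset_span ⟨y, hy, rfl⟩)
    apply IsFractionRing.injective R F
    rw [hf, h0, mul_zero, map_zero]
  · have := hf x
    rw [h, map_zero] at this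
    exact mul_ne_zero hd' hgx this.symm

/-- A direct summand of a finite direct sum of ideals is again a finite direct sum of ideals: split
off the range of a nonzero linear form and continue with its kernel, which has smaller rank. -/
theorem IsRetractOfIdeals.exists_linearEquiv_pi (hP : IsPruferDomain R) (hR : IsHLocalDomain R)
    {N : Type v} [AddCommGroup N] [Module R N] (hN : IsRetractOfIdeals R N) :
    ∃ (n : ℕ) (A : Fin n → Ideal R), Nonempty (N ≃ₗ[R] ∀ i, A i) := by
  obtain ⟨k, hk⟩ := hN.exists_rank_le
  induction k generalizing N with
  | zero =>
    have h0 : Module.IsTorsion R N := by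
      rw [← Module.rank_eq_zero_iff_isTorsion]
      simpa using hk
    obtain ⟨n, i, hi⟩ := hN.exists_injective
    have : Subsingleton N := by
      refine subsingleton_of_forall_eq 0 fun x => hi ?_
      obtain ⟨⟨r, hr⟩, hrx⟩ := @h0 x
      have h : r • i x = 0 := by rw [← map_smul]; exact (congrArg i hrx).trans (map_zero i)
      rw [map_zero]
      exact (smul_eq_zero.1 h).resolve_left (nonZeroDivisors.ne_zero hr)
    exact ⟨0, Fin.elim0, ⟨LinearEquiv.ofSubsingleton _ _⟩⟩
  | succ k ih =>
    by_cases hsub : Subsingleton N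
    · exact ⟨0, Fin.elim0, ⟨LinearEquiv.ofSubsingleton _ _⟩⟩
    rw [not_subsingleton_iff_nontrivial] at hsub
    obtain ⟨x, hx⟩ := exists_ne (0 : N)
    obtain ⟨n, i, hi⟩ := hN.exists_injective
    obtain ⟨j, hj⟩ : ∃ j, i x j ≠ 0 := by
      by_contra! h
      exact hx (hi (by rw [map_zero]; exact funext h))
    let f : N →ₗ[R] R := LinearMap.proj j ∘ₗ i
    obtain ⟨s, hs⟩ := hN.exists_section_range hP hR f
    obtain ⟨ρ, hρ⟩ := exists_retraction_ker hs
    have hker : ∀ y : LinearMap.ker f, ρ y = y := fun y => Subtype.ext <| by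
      rw [hρ, show f.rangeRestrict (y : N) = 0 from Subtype.ext y.2, map_zero, sub_zero]
    have hK : IsRetractOfIdeals R (LinearMap.ker f) := hN.of_retract (Submodule.subtype _) ρ hker
    obtain ⟨l, A, ⟨e⟩⟩ := ih hK (rank_le_of_forall_smul_notMem (x := x) (fun r hr h => hj
      (Submodule.isSaturated_ker f r x hr h)) hk)
    let E : N ≃ₗ[R] LinearMap.range f × LinearMap.ker f :=
      LinearEquiv.ofLinearMap (f.rangeRestrict.prod ρ) (s.coprod (Submodule.subtype _))
        (by
          apply LinearMap.ext
          rintro ⟨y, z⟩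
          have h1 : f.rangeRestrict (s y + z) = y := Subtype.ext <| by
            have hz : f z = 0 := z.2
            simp [hs, hz]
          refine Prod.ext h1 (Subtype.ext ?_)
          change (ρ (s y + z) : N) = z
          rw [hρ, h1, add_sub_cancel_left])
        (by
          apply LinearMap.ext
          intro y
          simp [hρ])
    exact ⟨l + 1, Fin.cons (LinearMap.range f) A, ⟨E ≪≫ₗ (LinearEquiv.refl R _).prodCongr e ≪≫ₗ
      Fin.consLinearEquiv R fun i => (Fin.cons (LinearMap.range f) A : Fin (l + 1) → Ideal R) i⟩⟩

/-- Saturated submodules of a retract of ideals are direct summands: unless `K` is everything, it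
lies in the kernel of a nonzero linear form, which is a direct summand of smaller rank. -/
theorem IsRetractOfIdeals.exists_retraction (hP : IsPruferDomain R) (hR : IsHLocalDomain R)
    {N : Type v} [AddCommGroup N] [Module R N] (hN : IsRetractOfIdeals R N) {K : Submodule R N}
    (hK : K.IsSaturated) : ∃ ρ : N →ₗ[R] K, ∀ x : K, ρ x = x := by
  obtain ⟨k, hk⟩ := hN.exists_rank_le
  have htop : K = ⊤ → ∃ ρ : N →ₗ[R] K, ∀ x : K, ρ x = x := by
    rintro rfl
    exact ⟨LinearMap.id.codRestrict ⊤ fun _ => Submodule.mem_top, fun _ => rfl⟩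
  induction k generalizing N with
  | zero =>
    apply htop
    rw [eq_top_iff]
    intro x _
    have h0 : Module.IsTorsion R N := by
      rw [← Module.rank_eq_zero_iff_isTorsion]
      simpa using hk
    obtain ⟨⟨r, hr⟩, hrx⟩ := @h0 x
    refine hK r x (nonZeroDivisors.ne_zero hr) ?_
    rw [show r • x = 0 from hrx]
    exact K.zero_mem
  | succ k ih =>
    by_cases hKtop : K = ⊤
    · exact htop hKtop
    obtain ⟨x, -, hx⟩ := SetLike.exists_of_lt (lt_top_iff_ne_top.2 hKtop)
    obtain ⟨n, i, hi⟩ := hN.exists_injective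
    obtain ⟨f, hKf, hfx⟩ := exists_linearMap_ne_zero_of_notMem hi hK hx
    obtain ⟨s, hs⟩ := hN.exists_section_range hP hR f
    obtain ⟨ρ, hρ⟩ := exists_retraction_ker hs
    have hker : ∀ y : LinearMap.ker f, ρ y = y := fun y => Subtype.ext <| by
      rw [hρ, show f.rangeRestrict (y : N) = 0 from Subtype.ext y.2, map_zero, sub_zero]
    have hker' : IsRetractOfIdeals R (LinearMap.ker f) :=
      hN.of_retract (Submodule.subtype _) ρ hker
    let K' := K.comap (LinearMap.ker f).subtype
    have hK' : K'.IsSaturated := fun r y hr hy => hK r y hr hy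
    obtain ⟨σ, hσ⟩ := ih hker' hK' (rank_le_of_forall_smul_notMem (x := x) (fun r hr h => hfx
      (Submodule.isSaturated_ker f r x hr h)) hk) (by
        intro h
        exact ⟨LinearMap.id.codRestrict _ fun y => h ▸ Submodule.mem_top, fun _ => rfl⟩)
    refine ⟨LinearMap.codRestrict K ((LinearMap.ker f).subtype ∘ₗ K'.subtype ∘ₗ σ ∘ₗ ρ)
      fun y => (σ (ρ y)).2, fun y => Subtype.ext ?_⟩
    have h1 : ρ y = ⟨y, hKf y.2⟩ := hker ⟨y, hKf y.2⟩
    have h2 : σ ⟨y, hKf y.2⟩ = ⟨⟨y, hKf y.2⟩, y.2⟩ := hσ ⟨⟨y, hKf y.2⟩, y.2⟩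
    change ((σ (ρ y) : LinearMap.ker f) : N) = y
    rw [h1, h2]

end Module

/-! ### Purity and saturation -/

section Purity

variable {R : Type u} [CommRing R]

theorem IsPureSubmodule.isSaturated [IsDomain R] {M : Type v} [AddCommGroup M] [Module R M]
    [Module.IsTorsionFree R M] {N : Submodule R M} (hN : IsPureSubmodule N) : N.IsSaturated := by
  intro r x hr hx
  obtain ⟨y, hy, hyx⟩ := hN 1 1 (fun _ _ => r) (fun _ => r • x) (fun _ => hx)
    ⟨fun _ => x, fun _ => by simp⟩
  have h : r • y 0 = r • x := by simpa using hyx 0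
  exact smul_right_injective M hr h ▸ hy 0

/-- A solution in `M` of a system with right-hand sides in `N` becomes a relation in the flat module
`M ⧸ N`, and this relation is a consequence of relations in a free module. -/
theorem isPureSubmodule_of_flat_quotient {M : Type v} [AddCommGroup M] [Module R M]
    (N : Submodule R M) [Module.Flat R (M ⧸ N)] : IsPureSubmodule N := by
  rintro n m r a ha ⟨x, hx⟩
  let X : (Fin m → R) →ₗ[R] M := Fintype.linearCombination R x
  let f : (Fin n → R) →ₗ[R] Fin m → R := Fintype.linearCombination R r
  have hX : ∀ c, X c = ∑ j, c j • x j := Fintype.linearCombination_apply R x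
  have hf : ∀ i, f (Pi.single i 1) = r i := fun i => by
    simp [f, Fintype.linearCombination_apply_single]
  have h0 : (N.mkQ ∘ₗ X) ∘ₗ f = 0 := by
    refine LinearMap.pi_ext' fun i => LinearMap.ext_ring ?_
    simp only [LinearMap.comp_apply, LinearMap.single_apply, LinearMap.zero_apply]
    rw [hf, hX, hx, ← LinearMap.mem_ker, Submodule.ker_mkQ]
    exact ha i
  obtain ⟨k, g, y, hgy, hgf⟩ := Module.Flat.exists_factorization_of_comp_eq_zero_of_free h0
  -- Lift the factorization through a free module to `M` and subtract it from the solution `x`.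
  obtain ⟨Y, hY⟩ := Module.projective_lifting_property N.mkQ y N.mkQ_surjective
  refine ⟨fun j => X (Pi.single j 1) - Y (g (Pi.single j 1)), fun j => ?_, fun i => ?_⟩
  · rw [← Submodule.ker_mkQ N, LinearMap.mem_ker, map_sub, sub_eq_zero]
    have h1 := LinearMap.congr_fun hgy (Pi.single j 1)
    have h2 := LinearMap.congr_fun hY (g (Pi.single j 1))
    exact h1.trans h2.symm
  · have hsum : ∑ j, r i j • (X (Pi.single j 1) - Y (g (Pi.single j 1))) = (X - Y ∘ₗ g) (r i) := by
      conv_rhs => rw [pi_eq_sum_univ' (r i), map_sum]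
      exact Finset.sum_congr rfl fun j _ => by
        rw [map_smul]
        rfl
    have hg : g (r i) = 0 := by
      rw [← hf i]
      exact LinearMap.congr_fun hgf _
    rw [hsum, LinearMap.sub_apply, LinearMap.comp_apply, hg, map_zero, sub_zero, hX, hx]

theorem Submodule.IsSaturated.isPureSubmodule [IsDomain R] (hR : IsPruferDomain R) {M : Type v}
    [AddCommGroup M] [Module R M] {N : Submodule R M} (hN : N.IsSaturated) :
    IsPureSubmodule N := by
  have : Module.IsTorsionFree R (M ⧸ N) := by
    refine Module.IsTorsionFree.of_smul_eq_zero fun r x h => ?_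
    obtain ⟨x, rfl⟩ := N.mkQ_surjective x
    rw [or_iff_not_imp_left]
    intro hr
    rw [← map_smul, ← LinearMap.mem_ker, Submodule.ker_mkQ] at h
    rw [← LinearMap.mem_ker, Submodule.ker_mkQ]
    exact hN r x hr h
  have := hR.flat (M ⧸ N)
  exact isPureSubmodule_of_flat_quotient N

end Purity

/-! ### Assembling direct sums -/

section DirectSum

variable {R : Type u} [CommRing R]

/-- The index type `Fin n` is lifted to the universe of the module, as in `IsDirectSumOfIdeals`. -/
theorem IsDirectSumOfIdeals.of_linearEquiv_pi {N : Type v} [AddCommGroup N] [Module R N] {n : ℕ}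
    {A : Fin n → Ideal R} (e : N ≃ₗ[R] ∀ i, A i) : IsDirectSumOfIdeals R N := by
  classical
  let E : (∀ i : ULift.{v} (Fin n), A (Equiv.ulift i)) ≃ₗ[R] ∀ i, A i :=
    LinearEquiv.piCongrLeft R (fun i => A i) Equiv.ulift
  exact ⟨ULift.{v} (Fin n), fun i => A (Equiv.ulift i), ⟨e ≪≫ₗ E.symm ≪≫ₗ
    (DirectSum.linearEquivFunOnFintype R _ fun i => A (Equiv.ulift i)).symm⟩⟩

theorem IsDirectSumOfIdeals.of_isInternal {M : Type v} [AddCommGroup M] [Module R M]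
    {D : ℕ → Submodule R M} (hD : DirectSum.IsInternal D)
    (h : ∀ n, IsDirectSumOfIdeals R (D n)) : IsDirectSumOfIdeals R M := by
  classical
  choose ι I e using h
  let e' := fun n => (e n).some
  let E : (DirectSum ℕ fun n => D n) ≃ₗ[R] M :=
    LinearEquiv.ofBijective (DirectSum.coeLinearMap D) hD
  exact ⟨Σ n, ι n, fun i => I i.1 i.2, ⟨E.symm ≪≫ₗ DirectSum.congrLinearEquiv e' ≪≫ₗ
    (DirectSum.sigmaLcurryEquiv R (δ := fun n i => I n i)).symm⟩⟩

/-- If `N 0 ⊆ N 1 ⊆ ⋯` exhausts `M`, starts at `0`, and `D n` complements `N n` in `N (n + 1)`, then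
`M` is the internal direct sum of the `D n`. -/
theorem Submodule.isInternal_of_chain {M : Type v} [AddCommGroup M] [Module R M]
    {N D : ℕ → Submodule R M} (hbot : N 0 = ⊥) (htop : ⨆ n, N n = ⊤)
    (hdisj : ∀ n, Disjoint (N n) (D n)) (hsup : ∀ n, N n ⊔ D n = N (n + 1)) :
    DirectSum.IsInternal D := by
  classical
  have hmono : Monotone N := monotone_nat_of_le_succ fun n => hsup n ▸ le_sup_left
  have hDN : ∀ n, D n ≤ N (n + 1) := fun n => hsup n ▸ le_sup_right
  have hmem : ∀ (n : ℕ) (x : DirectSum ℕ fun n => D n), (∀ k, n ≤ k → x k = 0) →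
      DirectSum.coeLinearMap D x ∈ N n := by
    intro n x hx
    rw [DirectSum.coeLinearMap_eq_dfinsuppSum]
    refine Submodule.sum_mem _ fun k hk => ?_
    have hkn : k < n := by
      by_contra hkn
      exact DFinsupp.mem_support_iff.1 hk (hx k (not_lt.1 hkn))
    exact hmono hkn (hDN k (x k).2)
  -- In a relation of length `n + 1` the top term lies in `N n ⊓ D n = ⊥`,
  -- so the relation has length `n`.
  have hinj : ∀ (n : ℕ) (x : DirectSum ℕ fun n => D n), (∀ k, n ≤ k → x k = 0) →
      DirectSum.coeLinearMap D x = 0 → x = 0 := by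
    intro n
    induction n with
    | zero => exact fun x hx _ => DFinsupp.ext fun k => hx k k.zero_le
    | succ n ih =>
      intro x hx h0
      let y : DirectSum ℕ fun n => D n := x - DirectSum.of (fun n => D n) n (x n)
      have hy : ∀ k, n ≤ k → y k = 0 := by
        intro k hk
        change x k - DirectSum.of (fun n => D n) n (x n) k = 0
        rcases hk.eq_or_lt with rfl | hk
        · rw [DirectSum.of_eq_same, sub_self]
        · rw [DirectSum.of_eq_of_ne _ _ _ hk.ne', hx k hk, sub_zero]
      have hxn : DirectSum.coeLinearMap D y = -(x n : M) := by
        rw [map_sub, h0, DirectSum.coeLinearMap_of, zero_sub]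
      have h1 : (x n : M) ∈ N n := by
        rw [← neg_mem_iff, ← hxn]
        exact hmem n y hy
      have h2 : x n = 0 := Subtype.ext (Submodule.disjoint_def.1 (hdisj n) _ h1 (x n).2)
      refine ih x (fun k hk => ?_) h0
      rcases hk.eq_or_lt with rfl | hk
      · exact h2
      · exact hx k hk
  refine ⟨(injective_iff_map_eq_zero (DirectSum.coeLinearMap D)).2 fun x hx => ?_, ?_⟩
  · obtain ⟨n, hn⟩ := (DFinsupp.support x).exists_nat_subset_range
    refine hinj n x (fun k hk => ?_) hx
    by_contra hk0
    exact absurd (Finset.mem_range.1 (hn (DFinsupp.mem_support_iff.2 hk0))) (not_lt.2 hk)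
  · have hle : ∀ n, N n ≤ ⨆ k, D k := by
      intro n
      induction n with
      | zero => simp [hbot]
      | succ n ih => exact hsup n ▸ sup_le ih (le_iSup D n)
    have hrange : LinearMap.range (DirectSum.coeLinearMap D) = ⊤ := by
      rw [DirectSum.range_coeLinearMap, eq_top_iff, ← htop]
      exact iSup_le hle
    exact LinearMap.range_eq_top.1 hrange

end DirectSum

/-! ### Modules of finite and countable rank -/

section Saturation

variable {R : Type u} [CommRing R] [IsDomain R]

/-- The saturation of `K`: the elements with a nonzero multiple in `K`. -/
def Submodule.saturation {M : Type v} [AddCommGroup M] [Module R M] (K : Submodule R M) :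
    Submodule R M where
  carrier := {x | ∃ r : R, r ≠ 0 ∧ r • x ∈ K}
  zero_mem' := ⟨1, one_ne_zero, by simp⟩
  add_mem' := by
    rintro x y ⟨r, hr, hx⟩ ⟨t, ht, hy⟩
    refine ⟨r * t, mul_ne_zero hr ht, ?_⟩
    rw [smul_add, mul_comm r t, mul_smul, mul_comm t r, mul_smul]
    exact K.add_mem (K.smul_mem _ hx) (K.smul_mem _ hy)
  smul_mem' := by
    rintro c x ⟨r, hr, hx⟩
    exact ⟨r, hr, by rw [smul_comm]; exact K.smul_mem _ hx⟩

theorem Submodule.le_saturation {M : Type v} [AddCommGroup M] [Module R M] (K : Submodule R M) :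
    K ≤ K.saturation :=
  fun x hx => ⟨1, one_ne_zero, by rwa [one_smul]⟩

theorem Submodule.isSaturated_saturation {M : Type v} [AddCommGroup M] [Module R M]
    (K : Submodule R M) : K.saturation.IsSaturated := by
  rintro r x hr ⟨t, ht, hx⟩
  exact ⟨t * r, mul_ne_zero ht hr, by rwa [mul_smul]⟩

theorem Submodule.rank_saturation {M : Type v} [AddCommGroup M] [Module R M]
    (K : Submodule R M) : Module.rank R K.saturation = Module.rank R K := by
  have h := rank_quotient_add_rank_of_isDomain (K.submoduleOf K.saturation)
  have h0 : Module.rank R (K.saturation ⧸ K.submoduleOf K.saturation) = 0 := by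
    rw [Module.rank_eq_zero_iff_isTorsion]
    intro x
    obtain ⟨x, rfl⟩ := Submodule.mkQ_surjective _ x
    obtain ⟨r, hr, hx⟩ := x.2
    refine ⟨⟨r, mem_nonZeroDivisors_of_ne_zero hr⟩, ?_⟩
    change r • (K.submoduleOf K.saturation).mkQ x = 0
    rw [← map_smul, ← LinearMap.mem_ker, Submodule.ker_mkQ]
    exact hx
  rw [← h, h0, zero_add]
  exact (Submodule.submoduleOfEquivOfLe K.le_saturation).rank_eq

/-- The chain consists of the saturations of the spans of the initial segments of an enumeration of
a maximal linearly independent set. -/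
theorem exists_saturated_chain {M : Type v} [AddCommGroup M] [Module R M]
    [Module.IsTorsionFree R M] (hM : Module.rank R M ≤ Cardinal.aleph0) :
    ∃ N : ℕ → Submodule R M, N 0 = ⊥ ∧ Monotone N ∧ ⨆ n, N n = ⊤ ∧ (∀ n, (N n).IsSaturated) ∧
      ∀ n, Module.rank R (N n) < Cardinal.aleph0 := by
  obtain ⟨s, hs, hmax⟩ := exists_maximal_linearIndepOn R (id : M → M)
  have hcount : s.Countable := by
    rw [← Cardinal.le_aleph0_iff_set_countable]
    exact (LinearIndependent.cardinal_le_rank hs).trans hM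
  -- Adjoining `0` makes the set nonempty, so that it is the range of a sequence even if `M = 0`.
  obtain ⟨e, he⟩ := (hcount.insert 0).exists_eq_range (Set.insert_nonempty 0 s)
  let S : ℕ → Submodule R M := fun n => Submodule.span R (e '' Set.Iio n)
  have hS : Monotone S := fun a b hab =>
    Submodule.span_mono (Set.image_mono (Set.Iio_subset_Iio hab))
  have hmono : Monotone fun n => (S n).saturation := fun a b hab x ⟨r, hr, hx⟩ =>
    ⟨r, hr, hS hab hx⟩
  refine ⟨fun n => (S n).saturation, ?_, hmono, ?_, fun n => (S n).isSaturated_saturation, ?_⟩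
  · rw [eq_bot_iff]
    rintro x ⟨r, hr, hx⟩
    simp only [S, Set.Iio_zero_eq_empty, Set.image_empty, Submodule.span_empty,
      Submodule.mem_bot] at hx
    exact (smul_eq_zero.1 hx).resolve_left hr
  · rw [eq_top_iff]
    intro x _
    have hx : ∃ r : R, r ≠ 0 ∧ r • x ∈ Submodule.span R s := by
      by_cases hxs : x ∈ s
      · exact ⟨1, one_ne_zero, by rw [one_smul]; exact Submodule.subset_span hxs⟩
      · simpa using hmax x hxs
    obtain ⟨r, hr, hx⟩ := hx
    have hle : Submodule.span R s ≤ ⨆ n, S n := by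
      rw [Submodule.span_le]
      intro y hy
      obtain ⟨n, rfl⟩ : y ∈ Set.range e := he ▸ Set.mem_insert_of_mem 0 hy
      exact le_iSup S (n + 1) (Submodule.subset_span ⟨n, Nat.lt_succ_self n, rfl⟩)
    obtain ⟨n, hn⟩ := (Submodule.mem_iSup_of_directed S hS.directed_le).1 (hle hx)
    exact le_iSup (fun n => (S n).saturation) n ⟨r, hr, hn⟩
  · intro n
    have : Module.Finite R (S n) := Module.Finite.span_of_finite R ((Set.finite_Iio n).image e)
    rw [Submodule.rank_saturation]
    exact Module.rank_lt_aleph0 R (S n)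

/-- The image of a finite-rank module in a direct sum of torsion-free modules involves only finitely
many summands, namely those met by a maximal linearly independent set. -/
theorem exists_finset_forall_apply_eq_zero {N : Type v} [AddCommGroup N] [Module R N]
    (hN : Module.rank R N < Cardinal.aleph0) {ι : Type*} {P : ι → Type*}
    [∀ i, AddCommGroup (P i)] [∀ i, Module R (P i)] [∀ i, Module.IsTorsionFree R (P i)]
    (f : N →ₗ[R] DirectSum ι P) : ∃ T : Finset ι, ∀ i ∉ T, ∀ x, f x i = 0 := by
  classical
  obtain ⟨s, hs, hmax⟩ := exists_maximal_linearIndepOn R (id : N → N)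
  have hfin : s.Finite := by
    rw [← Cardinal.lt_aleph0_iff_set_finite]
    exact (LinearIndependent.cardinal_le_rank hs).trans_lt hN
  refine ⟨hfin.toFinset.biUnion fun x => DFinsupp.support (f x), fun i hi x => ?_⟩
  let g : N →ₗ[R] P i := DirectSum.component R ι P i ∘ₗ f
  have hspan : Submodule.span R s ≤ LinearMap.ker g := by
    rw [Submodule.span_le]
    intro y hy
    by_contra hne
    exact hi (Finset.mem_biUnion.2 ⟨y, hfin.mem_toFinset.2 hy, DFinsupp.mem_support_iff.2 hne⟩)
  by_cases hx : x ∈ s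
  · exact hspan (Submodule.subset_span hx)
  · obtain ⟨r, hr, hrx⟩ := hmax x hx
    rw [Set.image_id] at hrx
    exact Submodule.isSaturated_ker g r x hr (hspan hrx)

/-- A finite-rank module with a saturated embedding into a direct sum of ideals is a retract of a
finite partial sum. -/
theorem isRetractOfIdeals_of_injective (hP : IsPruferDomain R) (hR : IsHLocalDomain R)
    {N : Type v} [AddCommGroup N] [Module R N] (hN : Module.rank R N < Cardinal.aleph0)
    {ι : Type*} {I : ι → Ideal R} {f : N →ₗ[R] DirectSum ι fun i => I i}
    (hf : Function.Injective f) (hsat : (LinearMap.range f).IsSaturated) :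
    IsRetractOfIdeals R N := by
  classical
  obtain ⟨T, hT⟩ := exists_finset_forall_apply_eq_zero hN f
  let g : N →ₗ[R] ∀ i : (T : Set ι), I i :=
    LinearMap.pi fun i => DirectSum.component R ι (fun i => I i) i ∘ₗ f
  -- Extending `g x` by zero outside `T` recovers `f x`.
  have hmk : ∀ x, DirectSum.lmk R ι (fun i => I i) T (g x) = f x := by
    intro x
    refine DFinsupp.ext fun i => ?_
    by_cases hi : i ∈ T
    · exact DirectSum.mk_apply_of_mem hi
    · exact (DirectSum.mk_apply_of_notMem hi).trans (hT i hi x).symm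
  have hmkinj : Function.Injective (DirectSum.lmk R ι (fun i => I i) T) :=
    DirectSum.mk_injective T
  have hg : Function.Injective g := fun x y hxy => hf (by rw [← hmk x, ← hmk y, hxy])
  have hgsat : (LinearMap.range g).IsSaturated := by
    rintro r y hr ⟨x, hx⟩
    obtain ⟨z, hz⟩ := hsat r (DirectSum.lmk R ι (fun i => I i) T y) hr
      ⟨x, by rw [← hmk, hx, map_smul]⟩
    exact ⟨z, hmkinj (by rw [hmk, hz])⟩
  have hpi : IsRetractOfIdeals R (∀ i : (T : Set ι), I i) := isRetractOfIdeals_pi _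
  obtain ⟨ρ, hρ⟩ := hpi.exists_retraction hP hR hgsat
  let e := LinearEquiv.ofInjective g hg
  exact hpi.of_retract g (e.symm.toLinearMap ∘ₗ ρ) fun x =>
    (congrArg e.symm (hρ (e x))).trans (e.symm_apply_apply x)

theorem IsRetractOfIdeals.isDirectSumOfIdeals (hP : IsPruferDomain R) (hR : IsHLocalDomain R)
    {N : Type v} [AddCommGroup N] [Module R N] (hN : IsRetractOfIdeals R N) :
    IsDirectSumOfIdeals R N := by
  obtain ⟨n, A, ⟨e⟩⟩ := hN.exists_linearEquiv_pi hP hR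
  exact .of_linearEquiv_pi e

theorem IsRetractOfIdeals.exists_complement (hP : IsPruferDomain R) (hR : IsHLocalDomain R)
    {M : Type v} [AddCommGroup M] [Module R M] {K N : Submodule R M} (hN : IsRetractOfIdeals R N)
    (hKN : K ≤ N) (hK : K.IsSaturated) :
    ∃ D : Submodule R M, Disjoint K D ∧ K ⊔ D = N ∧ IsRetractOfIdeals R D := by
  have hK' : (K.submoduleOf N).IsSaturated := fun r x hr hx => hK r x hr hx
  obtain ⟨ρ, hρ⟩ := hN.exists_retraction hP hR hK'
  let e := N.equivSubtypeMap (LinearMap.ker ρ)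
  refine ⟨(LinearMap.ker ρ).map N.subtype, ?_, le_antisymm (sup_le hKN ?_) ?_, ?_⟩
  · rw [Submodule.disjoint_def]
    rintro _ hxK ⟨x, hx, rfl⟩
    have h1 := hρ ⟨x, hxK⟩
    rw [show ρ x = 0 from hx] at h1
    exact congrArg (fun z : K.submoduleOf N => ((z : N) : M)) h1.symm
  · rintro _ ⟨x, -, rfl⟩
    exact x.2
  · intro x hx
    have hsplit : x = ((ρ ⟨x, hx⟩ : N) : M) + ((⟨x, hx⟩ - ρ ⟨x, hx⟩ : N) : M) := by simp
    rw [hsplit]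
    refine Submodule.add_mem_sup (ρ ⟨x, hx⟩).2 ⟨⟨x, hx⟩ - ρ ⟨x, hx⟩, ?_, rfl⟩
    change ρ (⟨x, hx⟩ - ρ ⟨x, hx⟩) = 0
    rw [map_sub, hρ, sub_self]
  · let q : N →ₗ[R] LinearMap.ker ρ :=
      LinearMap.codRestrict _ (LinearMap.id - (K.submoduleOf N).subtype ∘ₗ ρ) fun x => by
        simp [hρ]
    refine hN.of_retract ((LinearMap.ker ρ).subtype ∘ₗ e.symm.toLinearMap) (e.toLinearMap ∘ₗ q)
      fun x => ?_
    have hq : ∀ y : LinearMap.ker ρ, q y = y := fun y => Subtype.ext <| by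
      have hy : ρ y = 0 := y.2
      change (y : N) - ρ y = y
      rw [hy, Submodule.coe_zero, sub_zero]
    exact (congrArg e (hq (e.symm x))).trans (e.apply_symm_apply x)

end Saturation

/-! ### The criterion -/

theorem mainTheorem3 (R : Type u) [CommRing R] [IsDomain R]
    (hPrufer : IsPruferDomain R) (hLocal : IsHLocalDomain R)
    (M : Type v) [AddCommGroup M] [Module R M] [Module.IsTorsionFree R M]
    (hM : Module.rank R M ≤ Cardinal.aleph0) :
    IsDirectSumOfIdeals R M ↔
      ∀ N : Submodule R M, IsPureSubmodule N → Module.rank R N < Cardinal.aleph0 →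
        IsDirectSumOfIdeals R N := by
  constructor
  · rintro ⟨ι, I, ⟨e⟩⟩ N hN hrank
    have hinj : Function.Injective (e.toLinearMap ∘ₗ N.subtype) :=
      e.injective.comp N.injective_subtype
    refine (isRetractOfIdeals_of_injective hPrufer hLocal hrank hinj ?_).isDirectSumOfIdeals
      hPrufer hLocal
    rintro r y hr ⟨x, hx⟩
    have hy : r • e.symm y = x := by
      rw [← map_smul, ← hx]
      exact e.symm_apply_apply _
    exact ⟨⟨e.symm y, hN.isSaturated r _ hr (hy ▸ x.2)⟩, e.apply_symm_apply y⟩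
  · intro h
    -- Each term of the chain is a retract of ideals, so it splits off in the next one.
    obtain ⟨N, hbot, hmono, htop, hsat, hrank⟩ := exists_saturated_chain hM
    have hret : ∀ n, IsRetractOfIdeals R (N n) := by
      intro n
      obtain ⟨ι, I, ⟨e⟩⟩ := h (N n) ((hsat n).isPureSubmodule hPrufer) (hrank n)
      refine isRetractOfIdeals_of_injective hPrufer hLocal (hrank n) (f := e.toLinearMap)
        e.injective fun r y _ _ => ⟨e.symm y, e.apply_symm_apply y⟩
    choose D hdisj hsup hD using fun n =>
      (hret (n + 1)).exists_complement hPrufer hLocal (hmono n.le_succ) (hsat n)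
    exact .of_isInternal (Submodule.isInternal_of_chain hbot htop hdisj hsup) fun n =>
      (hD n).isDirectSumOfIdeals hPrufer hLocal
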